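/- Let $A$ and $B$ be commutative, associative, unital $\mathbb{C}$-algebras, let $f : A \to B$ be a $\mathbb{C}$-linear map and let $n \ge 1$. For $m \ge 1$ let $\Phi_m(f) : A^{\otimes m} \to B$ be the linear map with $$\Phi_m(f)(a_1 \otimes \cdots \otimes a_m) = \sum_{\sigma \in \Sigma_m} \varepsilon_\sigma\, f_{\gamma_1}(a_1,\dots,a_m) \cdots f_{\gamma_r}(a_1,\dots,a_m),$$ where $\Sigma_m$ is the symmetric group, $\varepsilon_\sigma$ is the sign of $\sigma$, $\sigma = \gamma_1 \cdots \gamma_r$ is the decomposition of $\sigma$ into disjoint cycles (fixed points counted as cycles of length one), and $f_\gamma(a_1,\dots,a_m) = f(a_{i_1} \cdots a_{i_k})$ for a cycle $\gamma = (i_1 \dots i_k)$. The map $f$ is called a Frobenius $n$-homomorphism if $f(1) = n$ and $\Phi_{n+1}(f) \equiv 0$. Let $\mathcal{S}^nA \subseteq A^{\otimes n}$ be the subalgebra of symmetric tensors, that is, of the elements invariant under all permutations of the tensor factors. **Theorem 1.9.** (i) If $f$ is a Frobenius $n$-homomorphism, then the map $\dfrac{\Phi_n(f)}{n!} : \mathcal{S}^nA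 \to B$ is a (unital) ring homomorphism. (ii) Conversely, if $f(1) = n$ and $\dfrac{\Phi_n(f)}{n!} : \mathcal{S}^nA \to B$ is a ring homomorphism, then $f$ is a Frobenius $n$-homomorphism. -/

import Mathlib

open scoped TensorProduct Nat

noncomputable section

section Phi

variable {ι A B : Type*} [Fintype ι] [CommRing A] [CommRing B] [Algebra ℂ A] [Algebra ℂ B]

open Classical in
/-- The product of `f (a i₁ * ⋯ * a iₘ)` over all disjoint cycles `(i₁ … iₘ)` of the permutation
`σ`; fixed points are cycles of length one. The cycles are the classes of
`Equiv.Perm.SameCycle σ`. -/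
def cycleProd (f : A →ₗ[ℂ] B) (σ : Equiv.Perm ι) (a : ι → A) : B :=
  ∏ c : Quotient (Equiv.Perm.SameCycle.setoid σ),
    f (∏ i with (Quotient.mk (Equiv.Perm.SameCycle.setoid σ) i) = c, a i)

open Classical in
theorem cycleProd_update [DecidableEq ι] (f : A →ₗ[ℂ] B) (σ : Equiv.Perm ι) (a : ι → A) (j : ι) (x : A) :
    cycleProd f σ (Function.update a j x) =
      f (x * ∏ i ∈ ({i | Quotient.mk (Equiv.Perm.SameCycle.setoid σ) i =
          Quotient.mk (Equiv.Perm.SameCycle.setoid σ) j} : Finset ι).erase j, a i) *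
      ∏ c ∈ Finset.univ.erase (Quotient.mk (Equiv.Perm.SameCycle.setoid σ) j),
        f (∏ i with (Quotient.mk (Equiv.Perm.SameCycle.setoid σ) i) = c, a i) := by
  unfold cycleProd
  rw [← Finset.mul_prod_erase _ _
    (Finset.mem_univ (Quotient.mk (Equiv.Perm.SameCycle.setoid σ) j))]
  congr 1
  · congr 1
    rw [← Finset.mul_prod_erase _ _ (a := j) (by simp)]
    rw [Function.update_self]
    congr 1
    refine Finset.prod_congr rfl fun i hi => ?_
    rw [Function.update_of_ne (Finset.ne_of_mem_erase hi)]
  · refine Finset.prod_congr rfl fun c hc => ?_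
    congr 1
    refine Finset.prod_congr rfl fun i hi => ?_
    rw [Function.update_of_ne]
    rintro rfl
    exact Finset.ne_of_mem_erase hc (Finset.mem_filter.mp hi).2.symm

variable [DecidableEq ι]

variable (ι) in
/-- `(aᵢ) ↦ ∑ σ, sign σ * f_{γ₁}(a) ⋯ f_{γᵣ}(a)`, where `σ = γ₁ ⋯ γᵣ` is the decomposition into
disjoint cycles, as a multilinear map. -/
def phiMultilinear (f : A →ₗ[ℂ] B) : MultilinearMap ℂ (fun _ : ι => A) B where
  toFun a := ∑ σ : Equiv.Perm ι, ((Equiv.Perm.sign σ : ℤ) : B) * cycleProd f σ a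
  map_update_add' a j x y := by
    rw [← Finset.sum_add_distrib]
    refine Finset.sum_congr rfl fun σ _ => ?_
    simp only [cycleProd_update, add_mul, map_add, mul_add]
  map_update_smul' a j z x := by
    rw [Finset.smul_sum]
    refine Finset.sum_congr rfl fun σ _ => ?_
    simp only [cycleProd_update, smul_mul_assoc, map_smul, mul_smul_comm]

end Phi

variable {A B : Type*} [CommRing A] [CommRing B] [Algebra ℂ A] [Algebra ℂ B]

/-- `Φ_n(f) : A^{⊗ n} → B`. -/
def Phi (n : ℕ) (f : A →ₗ[ℂ] B) : (⨂[ℂ] _ : Fin n, A) →ₗ[ℂ] B :=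
  PiTensorProduct.lift (phiMultilinear (Fin n) f)

/-- Frobenius `n`-homomorphisms: `f 1 = n` and `Φ_{n+1}(f) ≡ 0`. -/
def IsFrobeniusHom (n : ℕ) (f : A →ₗ[ℂ] B) : Prop :=
  f 1 = (n : B) ∧ Phi (n + 1) f = 0

/-- The permutation `σ` of the tensor factors is multiplicative. -/
theorem reindex_mul_tensor {n : ℕ} (σ : Equiv.Perm (Fin n)) (x y : ⨂[ℂ] _ : Fin n, A) :
    PiTensorProduct.reindex ℂ (fun _ => A) σ (x * y) =
      PiTensorProduct.reindex ℂ (fun _ => A) σ x * PiTensorProduct.reindex ℂ (fun _ => A) σ y := by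
  induction x using PiTensorProduct.induction_on with
  | add x₁ x₂ h₁ h₂ => simp only [add_mul, map_add, h₁, h₂]
  | smul_tprod r a =>
    induction y using PiTensorProduct.induction_on with
    | add y₁ y₂ h₁ h₂ => simp only [mul_add, map_add, h₁, h₂]
    | smul_tprod s b =>
      simp only [smul_mul_assoc, mul_smul_comm, map_smul, PiTensorProduct.tprod_mul_tprod,
        PiTensorProduct.reindex_tprod]
      rfl

variable (A) in
/-- The algebra `𝒮ⁿA` of symmetric tensors: the subalgebra of all elements of `A^{⊗ n}` that are
invariant under every permutation of the tensor factors. -/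
def symmetricTensors (n : ℕ) : Subalgebra ℂ (⨂[ℂ] _ : Fin n, A) where
  carrier := {x | ∀ σ : Equiv.Perm (Fin n), PiTensorProduct.reindex ℂ (fun _ => A) σ x = x}
  mul_mem' {x y} hx hy σ := by rw [reindex_mul_tensor, hx σ, hy σ]
  add_mem' {x y} hx hy σ := by rw [map_add, hx σ, hy σ]
  algebraMap_mem' r σ := by
    rw [Algebra.algebraMap_eq_smul_one, map_smul, PiTensorProduct.one_def,
      PiTensorProduct.reindex_tprod]
    rfl

/-- `Φ_n(f) / n! : 𝒮ⁿA → B`. -/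
def normalizedPhi (n : ℕ) (f : A →ₗ[ℂ] B) : symmetricTensors A n →ₗ[ℂ] B :=
  ((n ! : ℂ)⁻¹) • (Phi n f ∘ₗ (symmetricTensors A n).val.toLinearMap)

end

/-! ### Cycle products under relabelling and under adjoining one point -/

section CycleProd

open Equiv

/-! Write `s(a) = ∑ j, 1 ⊗ ⋯ ⊗ a ⊗ ⋯ ⊗ 1` (`tensorSum`). Sorting the permutations of `n + 1` points
by what they do with one point gives `Φ_{n+1}(f)(a ⊗ t) = f(a) Φ_n(f)(t) - Φ_n(f)(s(a) t)`. So
`Φ_{n+1}(f) = 0` says exactly that multiplication by `s(a)` passes through `Φ_n(f)` as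
multiplication by `f(a)` (`Phi_succ_eq_zero_iff`).

For (i), the `s(a)` generate the symmetric tensors (`symmetricTensors_le_adjoin`) and `Φ_n(f)(1) =
n!`, so multiplicativity spreads from generators by induction.

For (ii), `Φ_n(f)(s(a)) = n! f(a)`, so multiplicativity gives the identity on symmetric tensors; as
`Φ_n(f)` is permutation-invariant, averaging extends it to all tensors. -/

theorem cycleProd_eq_prod {ι β A B : Type*} [Fintype ι] [Fintype β] [DecidableEq β]
    [CommRing A] [CommRing B] [Algebra ℂ A] [Algebra ℂ B] (f : A →ₗ[ℂ] B) (σ : Perm ι) (p : ι → β)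
    (hp : Function.Surjective p) (h : ∀ x y, p x = p y ↔ σ.SameCycle x y) (a : ι → A) :
    cycleProd f σ a = ∏ b, f (∏ i with p i = b, a i) := by
  classical
  let q : Quotient (Perm.SameCycle.setoid σ) → β :=
    Quotient.lift p fun x y hxy => (h x y).2 hxy
  have hq : Function.Bijective q := by
    refine ⟨?_, fun b => ?_⟩
    · rintro ⟨x⟩ ⟨y⟩ hxy
      exact Quotient.sound ((h x y).1 hxy)
    · obtain ⟨x, rfl⟩ := hp b
      exact ⟨Quotient.mk _ x, rfl⟩
  unfold cycleProd
  refine Fintype.prod_bijective q hq _ _ fun c => ?_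
  congr 1
  refine Finset.prod_congr (Finset.filter_congr fun i _ => ?_) fun _ _ => rfl
  exact ⟨fun hi => by rw [← hi]; rfl, fun hi => hq.1 hi⟩

theorem cycleProd_permCongr {ι κ A B : Type*} [Fintype ι] [Fintype κ]
    [CommRing A] [CommRing B] [Algebra ℂ A] [Algebra ℂ B] (f : A →ₗ[ℂ] B) (e : ι ≃ κ)
    (σ : Perm ι) (a : κ → A) :
    cycleProd f (e.permCongr σ) a = cycleProd f σ (a ∘ e) := by
  classical
  have hcycle (x y : κ) :
      (e.permCongr σ).SameCycle x y ↔ σ.SameCycle (e.symm x) (e.symm y) := by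
    have hpow (n : ℤ) : (e.permCongr σ) ^ n = e.permCongr (σ ^ n) :=
      (map_zpow e.permCongrHom σ n).symm
    simp only [Perm.SameCycle, hpow, permCongr_apply, ← e.eq_symm_apply]
  rw [cycleProd_eq_prod f (e.permCongr σ)
    (fun x => Quotient.mk (Perm.SameCycle.setoid σ) (e.symm x))
    (Quotient.mk_surjective.comp e.symm.surjective)
    (fun x y => Quotient.eq.trans (hcycle x y).symm)]
  unfold cycleProd
  refine Finset.prod_congr rfl fun c _ => ?_
  congr 1
  symm
  refine Finset.prod_bij (fun i _ => e i) ?_ (fun _ _ _ _ hxy => e.injective hxy) ?_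
    fun _ _ => rfl
  · intro i hi
    simpa using hi
  · intro i hi
    exact ⟨e.symm i, by simpa using hi, by simp⟩

variable {ι A B : Type*} [Fintype ι] [CommRing A] [CommRing B] [Algebra ℂ A] [Algebra ℂ B]

theorem sameCycle_pow_apply {α : Type*} (σ : Perm α) (x : α) (n : ℕ) :
    σ.SameCycle x ((σ ^ n) x) := ⟨n, by simp⟩

theorem eq_of_sameCycle {α β : Type*} {σ : Perm α} {p : α → β} (hp : ∀ x, p (σ x) = p x)
    [Finite α] {x y : α} (h : σ.SameCycle x y) : p x = p y := by
  obtain ⟨n, rfl⟩ := h.exists_nat_pow_eq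
  induction n with
  | zero => rfl
  | succ n ih => rw [pow_succ', Perm.mul_apply, hp, ← ih (sameCycle_pow_apply σ x n)]

theorem sameCycle_of_sameCycle {α β : Type*} [Finite α] {σ : Perm α} {τ : Perm β} {g : α → β}
    (hg : ∀ x, τ.SameCycle (g x) (g (σ x))) {x y : α} (h : σ.SameCycle x y) :
    τ.SameCycle (g x) (g y) := by
  obtain ⟨n, rfl⟩ := h.exists_nat_pow_eq
  induction n with
  | zero => exact Perm.SameCycle.refl _ _
  | succ n ih =>
    rw [pow_succ', Perm.mul_apply]
    exact (ih (sameCycle_pow_apply σ x n)).trans (hg _)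

theorem cycleProd_optionCongr (f : A →ₗ[ℂ] B) (τ : Perm ι) (a : Option ι → A) :
    cycleProd f τ.optionCongr a = f (a none) * cycleProd f τ (a ∘ some) := by
  classical
  have hsome {x y : ι} (h : τ.SameCycle x y) :
      Perm.SameCycle τ.optionCongr (some x) (some y) :=
    sameCycle_of_sameCycle (fun x => ⟨1, by simp⟩) h
  let p : Option ι → Option (Quotient (Perm.SameCycle.setoid τ)) := Option.map (Quotient.mk _)
  have hinv (x : Option ι) : p (τ.optionCongr x) = p x := by
    cases x with
    | none => rfl
    | some x => exact congrArg some (Quotient.sound (Perm.SameCycle.symm ⟨1, by simp⟩))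
  have hp (x y : Option ι) : p x = p y ↔ Perm.SameCycle τ.optionCongr x y := by
    refine ⟨fun h => ?_, eq_of_sameCycle hinv⟩
    rcases x with _ | x <;> rcases y with _ | y
    · exact Perm.SameCycle.refl _ _
    · simp [p] at h
    · simp [p] at h
    · exact hsome (Quotient.exact (Option.some.inj h))
  have hsurj : Function.Surjective p := by
    rintro (_ | c)
    · exact ⟨none, rfl⟩
    · obtain ⟨x, rfl⟩ := Quotient.mk_surjective c
      exact ⟨some x, rfl⟩
  rw [cycleProd_eq_prod f _ p hsurj hp,
    Fintype.prod_option]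
  unfold cycleProd
  congr 1
  · simp [p, Finset.prod_filter]
  · refine Finset.prod_congr rfl fun c _ => ?_
    simp [p, Finset.prod_filter, Fintype.prod_option]

/-- The swap inserts `none` into the cycle of `i`, just before `some i`; no other cycle changes. -/
theorem cycleProd_swap_mul_optionCongr [DecidableEq ι] (f : A →ₗ[ℂ] B) (τ : Perm ι)
    (a : Option ι → A) (i : ι) :
    cycleProd f (swap none (some i) * τ.optionCongr) a =
      cycleProd f τ (Function.update (a ∘ some) i (a none * a (some i))) := by
  classical
  set σ : Perm (Option ι) := swap none (some i) * τ.optionCongr with hσ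
  have hσnone : σ none = some i := by simp [hσ]
  have hσsome (x : ι) (hx : τ x = i) : σ (some x) = none := by simp [hσ, hx]
  have hσsome' (x : ι) (hx : τ x ≠ i) : σ (some x) = some (τ x) := by
    simp [hσ, swap_apply_of_ne_of_ne, hx]
  have hnone : σ.SameCycle none (some i) := ⟨1, by simpa using hσnone⟩
  have hsome {x y : ι} (h : τ.SameCycle x y) : σ.SameCycle (some x) (some y) := by
    refine sameCycle_of_sameCycle (fun x => ?_) h
    by_cases hx : τ x = i
    · rw [hx]
      exact Perm.SameCycle.trans ⟨1, by simpa using hσsome x hx⟩ hnone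
    · exact ⟨1, by simpa using hσsome' x hx⟩
  have hτ (x : ι) : Quotient.mk (Perm.SameCycle.setoid τ) (τ x) = Quotient.mk _ x :=
    Quotient.sound (Perm.SameCycle.symm ⟨1, by simp⟩)
  -- The default `i` places `none` in the class of `i`, the cycle it has joined.
  let p : Option ι → Quotient (Perm.SameCycle.setoid τ) := fun x => Quotient.mk _ (x.getD i)
  have hinv (x : Option ι) : p (σ x) = p x := by
    cases x with
    | none => rw [hσnone]; rfl
    | some x =>
      by_cases hx : τ x = i
      · rw [hσsome x hx]
        exact (congrArg _ hx.symm).trans (hτ x)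
      · rw [hσsome' x hx]
        exact hτ x
  have hget (x : Option ι) : σ.SameCycle x (some (x.getD i)) := by
    cases x with
    | none => exact hnone
    | some x => exact Perm.SameCycle.refl _ _
  have hp (x y : Option ι) : p x = p y ↔ σ.SameCycle x y :=
    ⟨fun h => (hget x).trans ((hsome (Quotient.exact h)).trans (hget y).symm),
      eq_of_sameCycle hinv⟩
  have hsurj : Function.Surjective p := fun c => by
    obtain ⟨x, rfl⟩ := Quotient.mk_surjective c
    exact ⟨some x, rfl⟩
  rw [cycleProd_eq_prod f _ p hsurj hp]
  unfold cycleProd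
  refine Finset.prod_congr rfl fun c _ => ?_
  congr 1
  have hupd (j : ι) : Function.update (a ∘ some) i (a none * a (some i)) j =
      (if j = i then a none else 1) * a (some j) := by
    by_cases hj : j = i
    · subst hj; simp
    · simp [hj]
  rw [Finset.prod_congr rfl fun j _ => hupd j, Finset.prod_mul_distrib, Finset.prod_ite_eq',
    Finset.prod_filter, Fintype.prod_option, Finset.prod_filter]
  simp [p]

end CycleProd

/-! ### The recursion for `Φ` -/

section Recursion

open Equiv

variable {ι A B : Type*} [Fintype ι] [DecidableEq ι]
  [CommRing A] [CommRing B] [Algebra ℂ A] [Algebra ℂ B]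

theorem phiMultilinear_comp_equiv {κ : Type*} [Fintype κ] [DecidableEq κ] (f : A →ₗ[ℂ] B)
    (e : ι ≃ κ) (a : κ → A) :
    phiMultilinear ι f (a ∘ e) = phiMultilinear κ f a := by
  refine Fintype.sum_equiv e.permCongr _ _ fun σ => ?_
  rw [cycleProd_permCongr, Perm.sign_permCongr]

/-- Either `none` is a fixed point, contributing a factor `f (a none)`, or it is inserted before
some `i`, which costs a sign. -/
theorem phiMultilinear_option (f : A →ₗ[ℂ] B) (a : Option ι → A) :
    phiMultilinear (Option ι) f a = f (a none) * phiMultilinear ι f (a ∘ some) -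
      ∑ i, phiMultilinear ι f (Function.update (a ∘ some) i (a none * a (some i))) := by
  simp only [phiMultilinear, MultilinearMap.coe_mk]
  rw [← Perm.decomposeOption.symm.sum_comp, Fintype.sum_prod_type, Fintype.sum_option]
  simp only [Perm.decomposeOption_symm_apply, swap_self, cycleProd_swap_mul_optionCongr]
  simp only [← Perm.one_def, one_mul, optionCongr_sign, cycleProd_optionCongr]
  simp [Finset.mul_sum, sub_eq_add_neg, mul_left_comm]

theorem phiMultilinear_cons {n : ℕ} (f : A →ₗ[ℂ] B) (x : A) (a : Fin n → A) :
    phiMultilinear (Fin (n + 1)) f (Fin.cons x a) = f x * phiMultilinear (Fin n) f a -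
      ∑ i, phiMultilinear (Fin n) f (Function.update a i (x * a i)) := by
  rw [← phiMultilinear_comp_equiv f (finSuccEquiv n).symm, phiMultilinear_option]
  have h : (Fin.cons x a : Fin (n + 1) → A) ∘ (finSuccEquiv n).symm ∘ some = a := by
    ext i; simp
  simp only [Function.comp_assoc, h]
  simp

theorem phiMultilinear_one_cons {n : ℕ} (f : A →ₗ[ℂ] B) (a : Fin n → A) :
    phiMultilinear (Fin (n + 1)) f (Fin.cons 1 a) =
      (f 1 - n) * phiMultilinear (Fin n) f a := by
  simp [phiMultilinear_cons, sub_mul]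

theorem phiMultilinear_one (n k : ℕ) (f : A →ₗ[ℂ] B) (hf : f 1 = n) :
    phiMultilinear (Fin k) f 1 = (n.descFactorial k : B) := by
  induction k with
  | zero => simp [phiMultilinear, cycleProd]
  | succ k ih =>
    have h : (1 : Fin (k + 1) → A) = Fin.cons 1 1 := by
      ext i; cases i using Fin.cases <;> simp
    rw [h, phiMultilinear_one_cons, ih, hf, Nat.descFactorial_succ]
    -- For `k > n` the subtraction `n - k` truncates, but both sides vanish.
    obtain hk | hk := le_or_gt k n
    · push_cast [hk]; ring
    · simp [Nat.descFactorial_of_lt hk]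

end Recursion

/-! ### Generators of the algebra of symmetric tensors -/

section SymmetricTensors

variable {A : Type*} [CommRing A] [Algebra ℂ A] {n : ℕ}

/-- The tensor `1 ⊗ ⋯ ⊗ 1 ⊗ a ⊗ 1 ⊗ ⋯ ⊗ 1` with `a` in the `j`-th place, as an algebra map. -/
noncomputable abbrev tensorSingle (j : Fin n) : A →ₐ[ℂ] ⨂[ℂ] _ : Fin n, A :=
  PiTensorProduct.singleAlgHom (R := ℂ) (A := fun _ : Fin n => A) j

variable (n) in
/-- The symmetric tensor `∑ j, 1 ⊗ ⋯ ⊗ a ⊗ ⋯ ⊗ 1`. -/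
noncomputable def tensorSum (a : A) : ⨂[ℂ] _ : Fin n, A := ∑ j, tensorSingle j a

variable (n) in
/-- The sum over all placements of `a 0, …, a (k - 1)` in different tensor factors. -/
noncomputable def tensorMonomialSum {k : ℕ} (a : Fin k → A) : ⨂[ℂ] _ : Fin n, A :=
  ∑ e : Fin k ↪ Fin n, ∏ i, tensorSingle (e i) (a i)

theorem tensorSingle_mul_tprod (j : Fin n) (x : A) (a : Fin n → A) :
    tensorSingle j x * PiTensorProduct.tprod ℂ a =
      PiTensorProduct.tprod ℂ (Function.update a j (x * a j)) := by
  change PiTensorProduct.tprod ℂ (Pi.mulSingle j x) * PiTensorProduct.tprod ℂ a = _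
  rw [PiTensorProduct.tprod_mul_tprod]
  congr 1
  ext i
  by_cases h : i = j
  · subst h; simp
  · simp [h]

theorem prod_tensorSingle (a : Fin n → A) :
    ∏ i, tensorSingle i (a i) = PiTensorProduct.tprod ℂ a := by
  change ∏ i, PiTensorProduct.tprod ℂ (Pi.mulSingle i (a i)) = _
  rw [← PiTensorProduct.tprod_prod, Finset.univ_prod_mulSingle]

/-- In the product, `x` lands either in a free tensor factor or in one already holding some `a i`.
This is the same recursion as for `Φ`. -/
theorem tensorMonomialSum_cons {k : ℕ} (x : A) (a : Fin k → A) :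
    tensorMonomialSum n (Fin.cons x a : Fin (k + 1) → A) =
      tensorSum n x * tensorMonomialSum n a -
        ∑ i, tensorMonomialSum n (Function.update a i (x * a i)) := by
  classical
  have hupd (e : Fin k ↪ Fin n) (i : Fin k) :
      ∏ l, tensorSingle (e l) (Function.update a i (x * a i) l) =
        tensorSingle (e i) x * ∏ l, tensorSingle (e l) (a l) := by
    rw [← Finset.mul_prod_erase _ _ (Finset.mem_univ i), Function.update_self, map_mul,
      mul_assoc, ← Finset.mul_prod_erase _ (fun l => tensorSingle (e l) (a l)) (Finset.mem_univ i)]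
    congr 2
    refine Finset.prod_congr rfl fun l hl => ?_
    rw [Function.update_of_ne (Finset.ne_of_mem_erase hl)]
  simp only [tensorMonomialSum, tensorSum]
  rw [Finset.sum_comm, eq_sub_iff_add_eq, ← (Equiv.embeddingFinSucc k (Fin n)).symm.sum_comp,
    Fintype.sum_sigma, ← Finset.sum_add_distrib, Finset.mul_sum]
  refine Finset.sum_congr rfl fun e _ => ?_
  rw [Finset.sum_mul, ← Fintype.sum_subtype_add_sum_subtype (fun j => j ∈ Set.range e), add_comm]
  congr 1
  · simp only [hupd]
    convert Fintype.sum_equiv (Equiv.ofInjective e e.injective)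
      (fun i => tensorSingle (e i) x * ∏ l, tensorSingle (e l) (a l))
      (fun j : {j // j ∈ Set.range e} => tensorSingle j.1 x * ∏ l, tensorSingle (e l) (a l)) fun _ => rfl
  · refine Finset.sum_congr rfl fun j _ => ?_
    simp [Fin.prod_univ_succ]

theorem tensorMonomialSum_mem_adjoin {k : ℕ} (a : Fin k → A) :
    tensorMonomialSum n a ∈ Algebra.adjoin ℂ (Set.range (tensorSum (A := A) n)) := by
  induction k with
  | zero => simp [tensorMonomialSum, one_mem]
  | succ k ih =>
    rw [← Fin.cons_self_tail a, tensorMonomialSum_cons]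
    exact sub_mem (mul_mem (Algebra.subset_adjoin ⟨_, rfl⟩) (ih _)) (sum_mem fun i _ => ih _)

theorem sum_reindex_tprod (a : Fin n → A) :
    ∑ σ : Equiv.Perm (Fin n), PiTensorProduct.reindex ℂ (fun _ => A) σ
      (PiTensorProduct.tprod ℂ a) = tensorMonomialSum n a := by
  refine Fintype.sum_equiv (Equiv.embeddingEquivOfFinite (Fin n)).symm _ _ fun σ => ?_
  rw [PiTensorProduct.reindex_tprod, ← prod_tensorSingle]
  refine (σ.prod_comp _).symm.trans (Finset.prod_congr rfl fun i _ => ?_)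
  simp

theorem sum_reindex_mem_adjoin (x : ⨂[ℂ] _ : Fin n, A) :
    ∑ σ : Equiv.Perm (Fin n), PiTensorProduct.reindex ℂ (fun _ => A) σ x ∈
      Algebra.adjoin ℂ (Set.range (tensorSum (A := A) n)) := by
  induction x using PiTensorProduct.induction_on with
  | smul_tprod r a =>
    simp only [map_smul, ← Finset.smul_sum, sum_reindex_tprod]
    exact Subalgebra.smul_mem _ (tensorMonomialSum_mem_adjoin a) r
  | add x y hx hy =>
    simp only [map_add, Finset.sum_add_distrib]
    exact add_mem hx hy

theorem factorial_ne_zero_complex (n : ℕ) : (n ! : ℂ) ≠ 0 :=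
  Nat.cast_ne_zero.2 n.factorial_ne_zero

/-- Summing a symmetric tensor over all permutations multiplies it by `n!`, which is invertible. -/
theorem symmetricTensors_le_adjoin :
    symmetricTensors A n ≤ Algebra.adjoin ℂ (Set.range (tensorSum (A := A) n)) := by
  intro x hx
  have hx' := sum_reindex_mem_adjoin x
  rw [Finset.sum_congr rfl fun σ _ => hx σ, Finset.sum_const, Finset.card_univ,
    Fintype.card_perm, Fintype.card_fin, ← Nat.cast_smul_eq_nsmul ℂ] at hx'
  have := Subalgebra.smul_mem _ hx' (n ! : ℂ)⁻¹
  rwa [inv_smul_smul₀ (factorial_ne_zero_complex n)] at this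

theorem sum_reindex_mem_symmetricTensors (x : ⨂[ℂ] _ : Fin n, A) :
    ∑ σ : Equiv.Perm (Fin n), PiTensorProduct.reindex ℂ (fun _ => A) σ x ∈
      symmetricTensors A n := by
  intro τ
  rw [map_sum]
  refine Fintype.sum_equiv (Equiv.mulLeft τ) _ _ fun σ => ?_
  exact PiTensorProduct.reindex_reindex σ τ x

theorem reindex_tensorSum (σ : Equiv.Perm (Fin n)) (a : A) :
    PiTensorProduct.reindex ℂ (fun _ => A) σ (tensorSum n a) = tensorSum n a := by
  rw [tensorSum, map_sum]
  refine Fintype.sum_equiv σ _ _ fun j => ?_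
  change PiTensorProduct.reindex ℂ (fun _ => A) σ (PiTensorProduct.tprod ℂ (Pi.mulSingle j a)) =
    PiTensorProduct.tprod ℂ (Pi.mulSingle (σ j) a)
  rw [PiTensorProduct.reindex_tprod]
  congr 1
  ext i
  simp only [Pi.mulSingle_apply, Equiv.symm_apply_eq]

end SymmetricTensors

/-! ### Frobenius homomorphisms and multiplicativity -/

section Main

variable {A B : Type*} [CommRing A] [CommRing B] [Algebra ℂ A] [Algebra ℂ B] {n : ℕ}

theorem Phi_tprod (f : A →ₗ[ℂ] B) (a : Fin n → A) :
    Phi n f (PiTensorProduct.tprod ℂ a) = phiMultilinear (Fin n) f a :=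
  PiTensorProduct.lift.tprod a

theorem Phi_reindex (f : A →ₗ[ℂ] B) (σ : Equiv.Perm (Fin n)) (x : ⨂[ℂ] _ : Fin n, A) :
    Phi n f (PiTensorProduct.reindex ℂ (fun _ => A) σ x) = Phi n f x := by
  induction x using PiTensorProduct.induction_on with
  | smul_tprod r a =>
    rw [map_smul, map_smul, map_smul, PiTensorProduct.reindex_tprod, Phi_tprod, Phi_tprod]
    exact congrArg _ (phiMultilinear_comp_equiv f σ.symm a)
  | add x y hx hy => rw [map_add, map_add, map_add, hx, hy]

theorem Phi_one (f : A →ₗ[ℂ] B) (hf : f 1 = n) : Phi n f 1 = (n ! : B) := by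
  rw [PiTensorProduct.one_def, Phi_tprod, phiMultilinear_one n n f hf, Nat.descFactorial_self]

theorem phiMultilinear_cons_eq (f : A →ₗ[ℂ] B) (x : A) (a : Fin n → A) :
    phiMultilinear (Fin (n + 1)) f (Fin.cons x a) =
      f x * Phi n f (PiTensorProduct.tprod ℂ a) -
        Phi n f (tensorSum n x * PiTensorProduct.tprod ℂ a) := by
  simp only [phiMultilinear_cons, tensorSum, Finset.sum_mul, tensorSingle_mul_tprod, map_sum,
    Phi_tprod]

theorem Phi_succ_eq_zero_iff (f : A →ₗ[ℂ] B) :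
    Phi (n + 1) f = 0 ↔ ∀ a x, Phi n f (tensorSum n a * x) = f a * Phi n f x := by
  constructor
  · intro h a x
    induction x using PiTensorProduct.induction_on with
    | smul_tprod r v =>
      have := phiMultilinear_cons_eq f a v
      rw [← Phi_tprod, h, LinearMap.zero_apply, eq_comm, sub_eq_zero] at this
      rw [mul_smul_comm, map_smul, map_smul, ← this, mul_smul_comm]
    | add x y hx hy => rw [mul_add, map_add, map_add, hx, hy, mul_add]
  · intro h
    refine PiTensorProduct.ext (MultilinearMap.ext fun v => ?_)
    change Phi (n + 1) f (PiTensorProduct.tprod ℂ v) = 0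
    rw [Phi_tprod, ← Fin.cons_self_tail v, phiMultilinear_cons_eq, h, sub_self]

/-- Expand `Φ_{n+1}(f)(a, 1, …, 1)` along `a`. It vanishes: since `n ≥ 1`, some argument is `1`, and
moving it to the front produces the factor `f 1 - n = 0`. -/
theorem Phi_tensorSum (hn : 1 ≤ n) (f : A →ₗ[ℂ] B) (hf : f 1 = n) (a : A) :
    Phi n f (tensorSum n a) = n ! * f a := by
  obtain ⟨m, rfl⟩ := Nat.exists_eq_add_of_le' hn
  have hzero : phiMultilinear (Fin (m + 2)) f (Fin.cons a 1) = 0 := by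
    have hswap : (Fin.cons a 1 : Fin (m + 2) → A) ∘ Equiv.swap 0 1 =
        Fin.cons 1 (Fin.cons a 1 : Fin (m + 1) → A) := by
      ext i
      refine Fin.cases (by simp) (fun i => ?_) i
      refine Fin.cases (by simp) (fun i => ?_) i
      have hi : Equiv.swap (0 : Fin (m + 2)) 1 i.succ.succ = i.succ.succ :=
        Equiv.swap_apply_of_ne_of_ne (Fin.succ_ne_zero _)
          ((Fin.succ_injective _).ne (Fin.succ_ne_zero i))
      rw [Function.comp_apply, hi]
      rfl
    rw [← phiMultilinear_comp_equiv f (Equiv.swap 0 1), hswap, phiMultilinear_one_cons, hf,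
      sub_self, zero_mul]
  rw [phiMultilinear_cons_eq, ← PiTensorProduct.one_def, mul_one, Phi_one f hf, sub_eq_zero]
    at hzero
  rw [← hzero, mul_comm]

theorem normalizedPhi_apply (f : A →ₗ[ℂ] B) (x : symmetricTensors A n) :
    normalizedPhi n f x = (n ! : ℂ)⁻¹ • Phi n f x := rfl

theorem factorial_smul_eq_mul (b : B) : (n ! : ℂ) • b = n ! * b := by
  rw [Nat.cast_smul_eq_nsmul, nsmul_eq_mul]

theorem normalizedPhi_one (f : A →ₗ[ℂ] B) (hf : f 1 = n) : normalizedPhi n f 1 = 1 := by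
  rw [normalizedPhi_apply, OneMemClass.coe_one, Phi_one f hf, ← mul_one (n ! : B),
    ← factorial_smul_eq_mul, inv_smul_smul₀ (factorial_ne_zero_complex n)]

theorem IsFrobeniusHom.factorial_mul_Phi_mul {f : A →ₗ[ℂ] B} (hf : IsFrobeniusHom n f)
    {x : ⨂[ℂ] _ : Fin n, A} (hx : x ∈ symmetricTensors A n) (y : ⨂[ℂ] _ : Fin n, A) :
    (n ! : ℂ) • Phi n f (x * y) = Phi n f x * Phi n f y := by
  have hΦ := (Phi_succ_eq_zero_iff f).1 hf.2
  have hone := Phi_one f hf.1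
  replace hx := symmetricTensors_le_adjoin hx
  induction hx using Algebra.adjoin_induction generalizing y with
  | mem x hx =>
    obtain ⟨a, rfl⟩ := hx
    have h := hΦ a 1
    rw [mul_one, hone] at h
    rw [hΦ, h, factorial_smul_eq_mul]
    ring
  | algebraMap r =>
    rw [Algebra.algebraMap_eq_smul_one, smul_mul_assoc, one_mul, map_smul, map_smul, hone,
      factorial_smul_eq_mul, smul_mul_assoc, mul_smul_comm]
  | add x z _ _ hx hz => rw [add_mul, map_add, smul_add, hx, hz, map_add, add_mul]
  | mul x z _ _ hx hz =>
    -- After multiplying by `n!`, both sides become `Φ(x) Φ(z) Φ(y)`.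
    refine smul_right_injective B (factorial_ne_zero_complex n) ?_
    beta_reduce
    rw [mul_assoc, hx, ← mul_smul_comm, hz, ← smul_mul_assoc, hx, mul_assoc]

/-- The ring homomorphism `Φ_n(f) / n!` of a Frobenius `n`-homomorphism. -/
noncomputable def IsFrobeniusHom.ringHom {f : A →ₗ[ℂ] B} (hf : IsFrobeniusHom n f) :
    symmetricTensors A n →+* B where
  toFun := normalizedPhi n f
  map_one' := normalizedPhi_one f hf.1
  map_mul' x y := by
    rw [normalizedPhi_apply, normalizedPhi_apply, normalizedPhi_apply, smul_mul_smul_comm,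
      ← hf.factorial_mul_Phi_mul x.2, mul_smul, inv_smul_smul₀ (factorial_ne_zero_complex n)]
    rfl
  map_zero' := map_zero _
  map_add' := map_add _

theorem isFrobeniusHom_of_normalizedPhi_mul (hn : 1 ≤ n) (f : A →ₗ[ℂ] B) (hf : f 1 = n)
    (h : ∀ x y, normalizedPhi n f (x * y) = normalizedPhi n f x * normalizedPhi n f y) :
    IsFrobeniusHom n f := by
  refine ⟨hf, (Phi_succ_eq_zero_iff f).2 fun a x => ?_⟩
  have hn0 := factorial_ne_zero_complex n
  let s : symmetricTensors A n := ⟨tensorSum n a, fun σ => reindex_tensorSum σ a⟩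
  have hs : normalizedPhi n f s = f a := by
    rw [normalizedPhi_apply, Phi_tensorSum hn f hf, ← factorial_smul_eq_mul, inv_smul_smul₀ hn0]
  have hsymm (y : symmetricTensors A n) :
      Phi n f (tensorSum n a * y) = f a * Phi n f y := by
    have hy := h s y
    rw [hs, normalizedPhi_apply, normalizedPhi_apply, mul_smul_comm] at hy
    exact smul_right_injective B (inv_ne_zero hn0) hy
  have hsum (y : ⨂[ℂ] _ : Fin n, A) :
      Phi n f (∑ σ : Equiv.Perm (Fin n), PiTensorProduct.reindex ℂ (fun _ => A) σ y) =
        (n ! : ℂ) • Phi n f y := by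
    rw [map_sum, Finset.sum_congr rfl fun σ _ => Phi_reindex f σ y, Finset.sum_const,
      Finset.card_univ, Fintype.card_perm, Fintype.card_fin, Nat.cast_smul_eq_nsmul]
  have hx := hsymm ⟨_, sum_reindex_mem_symmetricTensors x⟩
  -- `s(a)` is invariant, so multiplying by it commutes with symmetrization.
  have hmul : tensorSum n a * ∑ σ : Equiv.Perm (Fin n),
      PiTensorProduct.reindex ℂ (fun _ => A) σ x =
        ∑ σ : Equiv.Perm (Fin n),
          PiTensorProduct.reindex ℂ (fun _ => A) σ (tensorSum n a * x) := by
    rw [Finset.mul_sum]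
    exact Finset.sum_congr rfl fun σ _ => by rw [reindex_mul_tensor, reindex_tensorSum]
  rw [hmul, hsum, hsum, mul_smul_comm] at hx
  exact smul_right_injective B hn0 hx

end Main

theorem theorem1p9 {A B : Type*} [CommRing A] [CommRing B] [Algebra ℂ A] [Algebra ℂ B]
    (n : ℕ) (hn : 1 ≤ n) (f : A →ₗ[ℂ] B) :
    (IsFrobeniusHom n f →
      ∃ g : symmetricTensors A n →+* B, ∀ x, g x = normalizedPhi n f x) ∧
    (f 1 = (n : B) →
      (∃ g : symmetricTensors A n →+* B, ∀ x, g x = normalizedPhi n f x) →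
      IsFrobeniusHom n f) := by
  refine ⟨fun hf => ⟨hf.ringHom, fun x => rfl⟩, fun hf => ?_⟩
  rintro ⟨g, hg⟩
  exact isFrobeniusHom_of_normalizedPhi_mul hn f hf fun x y => by
    rw [← hg, ← hg, ← hg, map_mul]
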